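/- Let $(M,J)$ be a connected complex manifold, that is, a connected Hausdorff finite-dimensional smooth manifold $M$ with a smooth field $J$ of endomorphisms of the tangent spaces such that $J^2=-\mathrm{Id}$ and $$[JX,JY]-J[X,JY]-J[JX,Y]-[X,Y]=0$$ for all smooth vector fields $X,Y$ on $M$. Let $\nabla$ be a smooth affine connection on $M$ with trivial holonomy, i.e. parallel transport along every piecewise smooth loop is the identity, and let $T(X,Y)=\nabla_XY-\nabla_YX-[X,Y]$ be its torsion. Let $\mathcal P^\nabla$ denote the real vector space of parallel vector fields, i.e. of smooth vector fields $X$ on $M$ with $\nabla X=0$. The connection $\nabla$ is called a Chern-type connection on $(M,J)$ if it has trivial holonomy, it is complex (that is, $\nabla J=0$: $\nabla_X(JY)=J\nabla_XY$ for all vector fields $X,Y$), and its torsion is of type $(2,0)$ (that is, $T(JX,Y)=J\,T(X,Y)$ for all vector fields $X,Y$). Then $\nabla$ is a Chern-type connection on $(M,J)$ if and only if $\mathcal P^\nabla$ is $J$-stable (that is, $JX\in\mathcal P^\nabla$ for all $X\in\mathcal P^\nabla$) and $$J[X,Y]=[X,JY]\qquad\text{for all } X,Y\in\mathcal P^\nabla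 .$$ -/

import Mathlib

open Set Bundle
open scoped Manifold ContDiff

noncomputable section

/-- Smooth vector fields on `M`. -/
abbrev SmoothVectorField (E : Type*) [NormedAddCommGroup E] [NormedSpace ℝ E]
    (M : Type*) [TopologicalSpace M] [ChartedSpace E M] [IsManifold 𝓘(ℝ, E) ∞ M] : Type _ :=
  ContMDiffSection 𝓘(ℝ, E) E ∞ (fun x : M => TangentSpace 𝓘(ℝ, E) x)

/-- Affine connections on `M`, as covariant derivatives on the tangent bundle: `∇_v Y` at `x`
is `cov Y x v`. Smoothness is the separate class `CovariantDerivative.ContMDiffCovariantDerivative cov ∞`. -/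
abbrev AffineConnection (E : Type*) [NormedAddCommGroup E] [NormedSpace ℝ E]
    (M : Type*) [TopologicalSpace M] [ChartedSpace E M] [IsManifold 𝓘(ℝ, E) ∞ M] : Type _ :=
  CovariantDerivative 𝓘(ℝ, E) E (fun x : M => TangentSpace 𝓘(ℝ, E) x)

/-- An almost complex structure: a smooth field of endomorphisms of the tangent spaces with
square minus the identity. -/
structure AlmostComplexStructure (E : Type*) [NormedAddCommGroup E] [NormedSpace ℝ E]
    (M : Type*) [TopologicalSpace M] [ChartedSpace E M] [IsManifold 𝓘(ℝ, E) ∞ M] where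
  /-- the endomorphism of each tangent space -/
  toFun : ∀ x : M, TangentSpace 𝓘(ℝ, E) x →L[ℝ] TangentSpace 𝓘(ℝ, E) x
  contMDiff_toFun : ContMDiff 𝓘(ℝ, E) (𝓘(ℝ, E).prod 𝓘(ℝ, E →L[ℝ] E)) ∞
    (fun x => TotalSpace.mk' (E →L[ℝ] E)
      (E := fun x : M => TangentSpace 𝓘(ℝ, E) x →L[ℝ] TangentSpace 𝓘(ℝ, E) x) x (toFun x))
  sq_eq_neg : ∀ (x : M) (v : TangentSpace 𝓘(ℝ, E) x), toFun x (toFun x v) = -v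

namespace AlmostComplexStructure

variable {E : Type*} [NormedAddCommGroup E] [NormedSpace ℝ E]
  {M : Type*} [TopologicalSpace M] [ChartedSpace E M] [IsManifold 𝓘(ℝ, E) ∞ M]

/-- The smooth vector field `JX`. -/
def apply (J : AlmostComplexStructure E M) (X : SmoothVectorField E M) :
    SmoothVectorField E M where
  toFun x := J.toFun x (X x)
  contMDiff_toFun := J.contMDiff_toFun.clm_bundle_apply X.contMDiff

/-- The Nijenhuis tensor `N(X, Y) = [JX, JY] - J[X, JY] - J[JX, Y] - [X, Y]`. -/
def nijenhuis (J : AlmostComplexStructure E M) (X Y : SmoothVectorField E M) (x : M) :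
    TangentSpace 𝓘(ℝ, E) x :=
  VectorField.mlieBracket 𝓘(ℝ, E) (J.apply X) (J.apply Y) x
    - J.toFun x (VectorField.mlieBracket 𝓘(ℝ, E) X (J.apply Y) x)
    - J.toFun x (VectorField.mlieBracket 𝓘(ℝ, E) (J.apply X) Y x)
    - VectorField.mlieBracket 𝓘(ℝ, E) X Y x

/-- `J` is integrable, that is, `(M, J)` is a complex manifold. -/
def IsIntegrable (J : AlmostComplexStructure E M) : Prop :=
  ∀ (X Y : SmoothVectorField E M) (x : M), J.nijenhuis X Y x = 0

end AlmostComplexStructure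

namespace AffineConnection

variable {E : Type*} [NormedAddCommGroup E] [NormedSpace ℝ E]
  {M : Type*} [TopologicalSpace M] [ChartedSpace E M] [IsManifold 𝓘(ℝ, E) ∞ M]

/-- The space of parallel vector fields: smooth vector fields `X` with `∇X = 0`. -/
def parallelFields (cov : AffineConnection E M) : Submodule ℝ (SmoothVectorField E M) where
  carrier := {X | ∀ x : M, cov.toFun X x = 0}
  add_mem' {X Y} hX hY x := by
    have h := cov.isCovariantDerivativeOnUniv.add
      ((X.contMDiff x).mdifferentiableAt (by simp))
      ((Y.contMDiff x).mdifferentiableAt (by simp)) (mem_univ x)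
    exact h.trans (by rw [hX x, hY x, add_zero])
  zero_mem' x := cov.isCovariantDerivativeOnUniv.zero (mem_univ x)
  smul_mem' c X hX x := by
    have h := cov.isCovariantDerivativeOnUniv.smul_const c
      ((X.contMDiff x).mdifferentiableAt (by simp)) (mem_univ x)
    exact h.trans (by rw [hX x, smul_zero])

/-- The covariant derivative `DV/dt` at time `t` of a vector field `V` along a curve `γ`.
In the local frame `(e_i)` of the tangent bundle given by the trivialization at `γ t`, write
`V s = ∑ f_i(s) e_i(γ s)`; then `DV/dt = ∑ f_i'(t) e_i(γ t) + ∇_{γ'(t)} (∑ f_i(t) e_i)`.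
Here `FiberBundle.extend E (V t)` is the local vector field `∑ f_i(t) e_i`. -/
def covDerivAlong (cov : AffineConnection E M) (γ : ℝ → M)
    (V : ∀ t : ℝ, TangentSpace 𝓘(ℝ, E) (γ t)) (t : ℝ) : TangentSpace 𝓘(ℝ, E) (γ t) :=
  (trivializationAt E (fun x : M => TangentSpace 𝓘(ℝ, E) x) (γ t)).symm (γ t)
      (deriv (fun s => (trivializationAt E (fun x : M => TangentSpace 𝓘(ℝ, E) x) (γ t)
        ⟨γ s, V s⟩).2) t)
    + cov.toFun (FiberBundle.extend E (V t)) (γ t) (mfderiv 𝓘(ℝ, ℝ) 𝓘(ℝ, E) γ t (1 : ℝ))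

/-- The vector field `V` along `γ` is parallel on `[0, 1]`: it is continuous, and away from the
endpoints and the finite set `P` of break points it is differentiable with `DV/dt = 0`. -/
structure IsParallelAlong (cov : AffineConnection E M) (γ : ℝ → M) (P : Finset ℝ)
    (V : ∀ t : ℝ, TangentSpace 𝓘(ℝ, E) (γ t)) : Prop where
  continuousOn : ContinuousOn (fun t => (⟨γ t, V t⟩ : TangentBundle 𝓘(ℝ, E) M)) (Icc 0 1)
  differentiableAt : ∀ t ∈ Ioo (0 : ℝ) 1, t ∉ P →
    MDifferentiableAt 𝓘(ℝ, ℝ) 𝓘(ℝ, E).tangent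
      (fun s => (⟨γ s, V s⟩ : TangentBundle 𝓘(ℝ, E) M)) t
  covDerivAlong_eq_zero : ∀ t ∈ Ioo (0 : ℝ) 1, t ∉ P → cov.covDerivAlong γ V t = 0

end AffineConnection

/-- The curve `γ : [0, 1] → M` is continuous, and smooth on each closed subinterval of `[0, 1]`
whose interior contains no point of the finite set `P`. (Values outside `[0, 1]` are irrelevant.) -/
structure IsPiecewiseSmoothCurve (E : Type*) [NormedAddCommGroup E] [NormedSpace ℝ E]
    {M : Type*} [TopologicalSpace M] [ChartedSpace E M] (γ : ℝ → M) (P : Finset ℝ) : Prop where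
  continuousOn : ContinuousOn γ (Icc 0 1)
  contMDiffOn : ∀ a b : ℝ, 0 ≤ a → a < b → b ≤ 1 → (∀ p ∈ P, p ∉ Ioo a b) →
    ContMDiffOn 𝓘(ℝ, ℝ) 𝓘(ℝ, E) ∞ γ (Icc a b)

namespace AffineConnection

variable {E : Type*} [NormedAddCommGroup E] [NormedSpace ℝ E]
  {M : Type*} [TopologicalSpace M] [ChartedSpace E M] [IsManifold 𝓘(ℝ, E) ∞ M]

/-- `γ` is piecewise smooth and parallel transport along it takes `v` to `w`. -/
def ParallelTransports (cov : AffineConnection E M) (γ : ℝ → M)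
    (v : TangentSpace 𝓘(ℝ, E) (γ 0)) (w : TangentSpace 𝓘(ℝ, E) (γ 1)) : Prop :=
  ∃ (P : Finset ℝ) (V : ∀ t : ℝ, TangentSpace 𝓘(ℝ, E) (γ t)),
    IsPiecewiseSmoothCurve E γ P ∧ cov.IsParallelAlong γ P V ∧ V 0 = v ∧ V 1 = w

/-- Trivial holonomy: parallel transport along every piecewise smooth loop, at every base point,
is the identity. -/
def HasTrivialHolonomy (cov : AffineConnection E M) : Prop :=
  ∀ γ : ℝ → M, γ 0 = γ 1 →
    ∀ (v : TangentSpace 𝓘(ℝ, E) (γ 0)) (w : TangentSpace 𝓘(ℝ, E) (γ 1)),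
      cov.ParallelTransports γ v w →
        (⟨γ 1, w⟩ : TangentBundle 𝓘(ℝ, E) M) = ⟨γ 0, v⟩

/-- `∇` is a complex connection: `∇J = 0`, that is, `∇_v (JY) = J ∇_v Y`. -/
def IsComplex (cov : AffineConnection E M) (J : AlmostComplexStructure E M) : Prop :=
  ∀ (Y : SmoothVectorField E M) (x : M) (v : TangentSpace 𝓘(ℝ, E) x),
    cov.toFun (J.apply Y) x v = J.toFun x (cov.toFun Y x v)

/-- The torsion `T` of `∇` is of type `(2, 0)`: `T(JX, Y) = J T(X, Y)`. -/
def HasTorsionOfTypeTwoZero [FiniteDimensional ℝ E] (cov : AffineConnection E M)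
    (J : AlmostComplexStructure E M) : Prop :=
  ∀ (x : M) (u v : TangentSpace 𝓘(ℝ, E) x),
    CovariantDerivative.torsion cov x (J.toFun x u) v
      = J.toFun x (CovariantDerivative.torsion cov x u v)

/-- `∇` is a Chern-type connection on `(M, J)`: a complex connection with trivial holonomy whose
torsion is of type `(2, 0)`. -/
structure IsChernType [FiniteDimensional ℝ E] (cov : AffineConnection E M)
    (J : AlmostComplexStructure E M) : Prop where
  isComplex : cov.IsComplex J
  hasTrivialHolonomy : cov.HasTrivialHolonomy
  torsion_type : cov.HasTorsionOfTypeTwoZero J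

end AffineConnection

end

/-! ### Covariant derivatives read in a trivialization. -/

noncomputable section

open Filter Topology

variable {E : Type*} [NormedAddCommGroup E] [NormedSpace ℝ E]
  {M : Type*} [TopologicalSpace M] [ChartedSpace E M]

/-! Both `∇J` and the torsion are tensors, so they are determined by their values on vector fields
that realize every tangent vector. With trivial holonomy on a connected manifold, the parallel
fields do this (`HasTrivialHolonomy.exists_parallelField`). On parallel `X, Y` one has `(∇J)Y =
∇(JY)` and `T(X, Y) = -[X, Y]`. Hence `∇J = 0` amounts to `J`-stability of the parallel fields and,
given that stability, the torsion condition amounts to `[JX, Y] = J[X, Y]`, which is the stated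
identity up to antisymmetry of the bracket.

Nearly all the work is the extension of a tangent vector `p` to a parallel field `X`. By
connectedness `p` can be transported to every point, and trivial holonomy makes the result
independent of the curve, so it defines a section `X` invariant under transport. Transport along a
short chart segment from `a` to `b` is a linear differential equation, whose solution satisfies `w =
v - Γ a v (b - a) + o(‖b - a‖)` (`IsChristoffel.exists_transports`). Invariance says that `w` is the
value of `X` at `b`, so in the chart `X` is a function `f` with `df = -Γ(f)`. Bootstrapping this
equation makes `f` smooth, and the equation itself says `∇X = 0`. -/

lemma mvfderiv_congr_of_eventuallyEq {f g : M → E} {y : M} (h : f =ᶠ[𝓝 y] g) :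
    mvfderiv 𝓘(ℝ, E) f y = mvfderiv 𝓘(ℝ, E) g y := by
  ext w
  simp only [mvfderiv, h.mfderiv_eq]
  rfl

variable [IsManifold 𝓘(ℝ, E) ∞ M]

/-- The local section of the tangent bundle with constant value `u` in the trivialization `e`. -/
def constSection (e : Trivialization E (π E (TangentSpace 𝓘(ℝ, E) : M → Type _))) (u : E) (y : M) :
    TangentSpace 𝓘(ℝ, E) y :=
  e.symm y u

section
variable (e : Trivialization E (π E (TangentSpace 𝓘(ℝ, E) : M → Type _)))

lemma trivialization_constSection (u : E) {y : M} (hy : y ∈ e.baseSet) :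
    e ⟨y, constSection e u y⟩ = (y, u) :=
  e.apply_mk_symm hy u

variable [MemTrivializationAtlas e]

lemma contMDiffAt_constSection (u : E) {y : M} (hy : y ∈ e.baseSet) :
    ContMDiffAt 𝓘(ℝ, E) (𝓘(ℝ, E).prod 𝓘(ℝ, E)) ∞
      (fun z => (⟨z, constSection e u z⟩ : TangentBundle 𝓘(ℝ, E) M)) y := by
  refine (e.contMDiffAt_section_iff hy).2 ?_
  refine (contMDiffAt_const (c := u)).congr_of_eventuallyEq ?_
  filter_upwards [e.open_baseSet.mem_nhds hy] with z hz
  rw [trivialization_constSection e u hz]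

lemma mdifferentiableAt_constSection (u : E) {y : M} (hy : y ∈ e.baseSet) :
    MDifferentiableAt 𝓘(ℝ, E) (𝓘(ℝ, E).prod 𝓘(ℝ, E))
      (fun z => (⟨z, constSection e u z⟩ : TangentBundle 𝓘(ℝ, E) M)) y :=
  (contMDiffAt_constSection e u hy).mdifferentiableAt (by simp)

lemma snd_trivialization_add {y : M} (hy : y ∈ e.baseSet) (v w : TangentSpace 𝓘(ℝ, E) y) :
    (e ⟨y, v + w⟩).2 = (e ⟨y, v⟩).2 + (e ⟨y, w⟩).2 :=
  (e.linear ℝ hy).map_add v w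

lemma snd_trivialization_smul {y : M} (hy : y ∈ e.baseSet) (c : ℝ) (v : TangentSpace 𝓘(ℝ, E) y) :
    (e ⟨y, c • v⟩).2 = c • (e ⟨y, v⟩).2 :=
  (e.linear ℝ hy).map_smul c v

/-- The covariant derivative of a vector field, in a trivialization: `∇_w X = dX(w) + Γ(w, X)`. -/
lemma trivialization_cov [FiniteDimensional ℝ E] (cov : AffineConnection E M) {y : M} (hy : y ∈ e.baseSet)
    {X : ∀ z : M, TangentSpace 𝓘(ℝ, E) z}
    (hX : MDifferentiableAt 𝓘(ℝ, E) (𝓘(ℝ, E).prod 𝓘(ℝ, E))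
      (fun z => (⟨z, X z⟩ : TangentBundle 𝓘(ℝ, E) M)) y) (w : TangentSpace 𝓘(ℝ, E) y) :
    (e ⟨y, cov.toFun X y w⟩).2 = mvfderiv 𝓘(ℝ, E) (fun z => (e ⟨z, X z⟩).2) y w +
      (e ⟨y, cov.toFun (constSection e (e ⟨y, X y⟩).2) y w⟩).2 := by
  have hd : ∀ {Z : ∀ z : M, TangentSpace 𝓘(ℝ, E) z},
      MDifferentiableAt 𝓘(ℝ, E) (𝓘(ℝ, E).prod 𝓘(ℝ, E))
      (fun z => (⟨z, Z z⟩ : TangentBundle 𝓘(ℝ, E) M)) y →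
      MDifferentiableAt 𝓘(ℝ, E) 𝓘(ℝ, E) (fun z => (e ⟨z, Z z⟩).2) y := fun h =>
    (e.mdifferentiableAt_section_iff 𝓘(ℝ, E) _ hy).1 h
  have hb := e.open_baseSet.mem_nhds hy
  -- The two Leibniz terms cancel in this difference, so it depends only on the value of `Z` at `y`.
  -- It can be evaluated on the constant section with that value, whose coordinate derivative
  -- vanishes.
  have key : TensorialAt 𝓘(ℝ, E) E (fun Z : ∀ z : M, TangentSpace 𝓘(ℝ, E) z =>
      (e ⟨y, cov.toFun Z y w⟩).2 - mvfderiv 𝓘(ℝ, E) (fun z => (e ⟨z, Z z⟩).2) y w) y := by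
    constructor
    · intro f σ hf hσ
      have h1 : mvfderiv 𝓘(ℝ, E) (fun z => (e ⟨z, (f • σ) z⟩).2) y =
          mvfderiv 𝓘(ℝ, E) (f • fun z => (e ⟨z, σ z⟩).2) y := by
        refine mvfderiv_congr_of_eventuallyEq ?_
        filter_upwards [hb] with z hz
        exact snd_trivialization_smul e hz _ _
      rw [h1, mvfderiv_smul hf (hd hσ), cov.isCovariantDerivativeOnUniv.leibniz hσ hf (mem_univ y)]
      simp only [add_apply, smul_apply,
        ContinuousLinearMap.smulRight_apply]
      rw [snd_trivialization_add e hy, snd_trivialization_smul e hy, snd_trivialization_smul e hy,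
        smul_sub]
      abel
    · intro σ σ' hσ hσ'
      have h1 : mvfderiv 𝓘(ℝ, E) (fun z => (e ⟨z, (σ + σ') z⟩).2) y =
          mvfderiv 𝓘(ℝ, E) ((fun z => (e ⟨z, σ z⟩).2) + fun z => (e ⟨z, σ' z⟩).2) y := by
        refine mvfderiv_congr_of_eventuallyEq ?_
        filter_upwards [hb] with z hz
        exact snd_trivialization_add e hz _ _
      rw [h1, mvfderiv_add (hd hσ) (hd hσ'),
        cov.isCovariantDerivativeOnUniv.add hσ hσ' (mem_univ y)]
      simp only [add_apply]
      rw [snd_trivialization_add e hy]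
      abel
  have hv : X y = constSection e (e ⟨y, X y⟩).2 y := (e.symm_apply_apply_mk hy (X y)).symm
  have h := key.pointwise hX (mdifferentiableAt_constSection e (e ⟨y, X y⟩).2 hy) hv
  have h0 : mvfderiv 𝓘(ℝ, E) (fun z => (e ⟨z, constSection e (e ⟨y, X y⟩).2 z⟩).2) y = 0 := by
    rw [mvfderiv_congr_of_eventuallyEq (g := fun _ => (e ⟨y, X y⟩).2), mvfderiv_const]
    filter_upwards [hb] with z hz
    rw [trivialization_constSection e _ hz]
  rw [h0] at h
  rw [← sub_eq_iff_eq_add', h]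
  simp

lemma mvfderiv_real_apply_one (f : ℝ → E) (t : ℝ) :
    mvfderiv 𝓘(ℝ, ℝ) f t (1 : ℝ) = deriv f t := by
  simp only [mvfderiv, mfderiv_eq_fderiv]
  rfl

/-- The covariant derivative along a curve, in a trivialization. -/
lemma trivialization_covDerivAlong [FiniteDimensional ℝ E] (cov : AffineConnection E M)
    {c : ℝ → TangentBundle 𝓘(ℝ, E) M} {t : ℝ}
    (hc : MDifferentiableAt 𝓘(ℝ, ℝ) 𝓘(ℝ, E).tangent c t) (hy : (c t).proj ∈ e.baseSet) :
    (e ⟨(c t).proj, cov.covDerivAlong (fun s => (c s).proj) (fun s => (c s).snd) t⟩).2 =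
      deriv (fun s => (e (c s)).2) t +
      (e ⟨(c t).proj, cov.toFun (constSection e (e (c t)).2) (c t).proj
        (mfderiv 𝓘(ℝ, ℝ) 𝓘(ℝ, E) (fun s => (c s).proj) t (1 : ℝ))⟩).2 := by
  set e' := trivializationAt E (fun x : M => TangentSpace 𝓘(ℝ, E) x) (c t).proj with he'
  have hy' : (c t).proj ∈ e'.baseSet := FiberBundle.mem_baseSet_trivializationAt' _
  have hγ : MDifferentiableAt 𝓘(ℝ, ℝ) 𝓘(ℝ, E) (fun s => (c s).proj) t :=
    ((mdifferentiableAt_totalSpace _ c).1 hc).1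
  have ha : DifferentiableAt ℝ (fun s => (e' (c s)).2) t :=
    ((mdifferentiableAt_totalSpace _ c).1 hc).2.differentiableAt
  -- `covDerivAlong` is built from the preferred trivialization `e'` at the current point. The
  -- coordinate change `T` carries it to `e`; the term produced by differentiating `T` along the
  -- curve is absorbed by `∇` of the `e'`-constant section.
  obtain ⟨T, hT, hTe⟩ : ∃ T : M → E →L[ℝ] E,
      MDifferentiableAt 𝓘(ℝ, E) 𝓘(ℝ, E →L[ℝ] E) T (c t).proj ∧
      ∀ z ∈ e'.baseSet ∩ e.baseSet, ∀ u, T z u = (e ⟨z, constSection e' u z⟩).2 :=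
    ⟨fun z => (e'.coordChangeL ℝ e z : E →L[ℝ] E), mdifferentiableAt_coordChangeL hy' hy,
      fun z hz u => e'.coordChangeL_apply e hz u⟩
  have hTγ : DifferentiableAt ℝ (fun s => T (c s).proj) t :=
    MDifferentiableAt.differentiableAt (hT.comp t hγ)
  have hmem : ∀ᶠ z in 𝓝 (c t).proj, z ∈ e'.baseSet ∩ e.baseSet :=
    (e'.open_baseSet.inter e.open_baseSet).mem_nhds ⟨hy', hy⟩
  have hb : (fun s => (e (c s)).2) =ᶠ[𝓝 t] fun s => T (c s).proj (e' (c s)).2 := by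
    filter_upwards [hγ.continuousAt.eventually hmem] with s hs
    rw [hTe _ hs, constSection, e'.symm_proj_apply _ hs.1]
  have hcv : constSection e' (e' (c t)).2 (c t).proj = (c t).snd := e'.symm_proj_apply _ hy'
  have hTu : mvfderiv 𝓘(ℝ, E) (fun z => (e ⟨z, constSection e' (e' (c t)).2 z⟩).2) (c t).proj
      (mfderiv 𝓘(ℝ, ℝ) 𝓘(ℝ, E) (fun s => (c s).proj) t (1 : ℝ)) =
      deriv (fun s => T (c s).proj) t (e' (c t)).2 := by
    have h1 : (fun z => (e ⟨z, constSection e' (e' (c t)).2 z⟩).2) =ᶠ[𝓝 (c t).proj]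
        fun z => T z (e' (c t)).2 := by
      filter_upwards [hmem] with z hz
      rw [hTe _ hz]
    have h2 : MDifferentiableAt 𝓘(ℝ, E) 𝓘(ℝ, E) (fun z => T z (e' (c t)).2) (c t).proj :=
      hT.clm_apply mdifferentiableAt_const
    rw [mvfderiv_congr_of_eventuallyEq h1]
    refine (mfderiv_comp_apply t h2 hγ (1 : ℝ)).symm.trans ?_
    refine (mvfderiv_real_apply_one (fun s => T (c s).proj (e' (c t)).2) t).trans ?_
    exact (hTγ.hasDerivAt.clm_apply (hasDerivAt_const t (e' (c t)).2)).deriv.trans (by simp)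
  have hX : MDifferentiableAt 𝓘(ℝ, E) (𝓘(ℝ, E).prod 𝓘(ℝ, E))
      (fun z => (⟨z, constSection e' (e' (c t)).2 z⟩ : TangentBundle 𝓘(ℝ, E) M)) (c t).proj :=
    mdifferentiableAt_constSection e' _ hy'
  have hcov := trivialization_cov e cov hy hX
    (mfderiv 𝓘(ℝ, ℝ) 𝓘(ℝ, E) (fun s => (c s).proj) t (1 : ℝ))
  rw [hTu, hcv] at hcov
  rw [hb.deriv_eq, (hTγ.hasDerivAt.clm_apply ha.hasDerivAt).deriv, AffineConnection.covDerivAlong,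
    snd_trivialization_add e hy, hTe _ ⟨hy', hy⟩]
  refine (congrArg _ hcov).trans ?_
  rw [← add_assoc]
  congr 1
  exact add_comm _ _

end
end

/-! ### Smooth Christoffel symbols in a chart. -/

noncomputable section

open Filter Topology

variable {E : Type*} [NormedAddCommGroup E] [NormedSpace ℝ E]
  {M : Type*} [TopologicalSpace M] [ChartedSpace E M] [IsManifold 𝓘(ℝ, E) ∞ M]

lemma cov_constSection_add (cov : AffineConnection E M)
    (e : Trivialization E (π E (TangentSpace 𝓘(ℝ, E) : M → Type _))) [MemTrivializationAtlas e]
    {y : M} (hy : y ∈ e.baseSet) (u v : E) :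
    cov.toFun (constSection e (u + v)) y =
      cov.toFun (constSection e u) y + cov.toFun (constSection e v) y := by
  have hu := mdifferentiableAt_constSection e u hy
  have hv := mdifferentiableAt_constSection e v hy
  rw [← cov.isCovariantDerivativeOnUniv.add hu hv (mem_univ y)]
  refine cov.isCovariantDerivativeOnUniv.congr_of_eventuallyEq
    (mdifferentiableAt_constSection e _ hy) (mdifferentiableAt_add_section hu hv) univ_mem ?_
  filter_upwards [e.open_baseSet.mem_nhds hy] with z hz
  simp only [constSection, Pi.add_apply, ← e.symmL_apply (R := ℝ) hz, map_add]

lemma cov_constSection_smul (cov : AffineConnection E M)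
    (e : Trivialization E (π E (TangentSpace 𝓘(ℝ, E) : M → Type _))) [MemTrivializationAtlas e]
    {y : M} (hy : y ∈ e.baseSet) (a : ℝ) (u : E) :
    cov.toFun (constSection e (a • u)) y = a • cov.toFun (constSection e u) y := by
  have hu := mdifferentiableAt_constSection e u hy
  rw [← cov.isCovariantDerivativeOnUniv.smul_const a hu (mem_univ y)]
  refine cov.isCovariantDerivativeOnUniv.congr_of_eventuallyEq
    (mdifferentiableAt_constSection e _ hy) (hu.smul_const_section) univ_mem ?_
  filter_upwards [e.open_baseSet.mem_nhds hy] with z hz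
  simp only [constSection, Pi.smul_apply, ← e.symmL_apply (R := ℝ) hz, map_smul]

variable [FiniteDimensional ℝ E] [T2Space M]

/-- A local vector field with constant coordinates agrees near the base point with a global one. -/
lemma exists_contMDiff_eventuallyEq_constSection (x₀ : M) (u : E) :
    ∃ σ : ∀ y : M, TangentSpace 𝓘(ℝ, E) y,
      ContMDiff 𝓘(ℝ, E) (𝓘(ℝ, E).prod 𝓘(ℝ, E)) ∞
        (fun z => (⟨z, σ z⟩ : TangentBundle 𝓘(ℝ, E) M)) ∧
      ∀ᶠ y in 𝓝 x₀, σ y = constSection (trivializationAt E _ x₀) u y := by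
  obtain ⟨f⟩ : Nonempty (SmoothBumpFunction 𝓘(ℝ, E) x₀) := inferInstance
  set e := trivializationAt E (TangentSpace 𝓘(ℝ, E) : M → Type _) x₀
  refine ⟨(f : M → ℝ) • constSection e u, ?_, ?_⟩
  · refine ContMDiffOn.smul_section_of_tsupport (F := E) (V := (TangentSpace 𝓘(ℝ, E) : M → Type _))
      (s := constSection e u) f.contMDiff.contMDiffOn e.open_baseSet
      f.tsupport_subset_chartAt_source ?_
    exact fun y hy => (contMDiffAt_constSection e u hy).contMDiffWithinAt
  · filter_upwards [f.eventuallyEq_one] with y hy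
    simp [hy]

/-- The Christoffel symbols of a smooth connection in the trivialization at `x₀`. -/
lemma exists_contMDiffOn_christoffel (cov : AffineConnection E M)
    [hcov : CovariantDerivative.ContMDiffCovariantDerivative cov ∞] (x₀ : M) (u : E) :
    ∃ (W : Set M) (Γ : M → E →L[ℝ] E), IsOpen W ∧ x₀ ∈ W ∧
      W ⊆ (trivializationAt E (TangentSpace 𝓘(ℝ, E) : M → Type _) x₀).baseSet ∧
      ContMDiffOn 𝓘(ℝ, E) 𝓘(ℝ, E →L[ℝ] E) ∞ Γ W ∧
      ∀ y ∈ W, ∀ w : TangentSpace 𝓘(ℝ, E) y,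
        (trivializationAt E (TangentSpace 𝓘(ℝ, E) : M → Type _) x₀ ⟨y,
          cov.toFun (constSection (trivializationAt E _ x₀) u) y w⟩).2 =
        Γ y (trivializationAt E (TangentSpace 𝓘(ℝ, E) : M → Type _) x₀ ⟨y, w⟩).2 := by
  set e := trivializationAt E (TangentSpace 𝓘(ℝ, E) : M → Type _) x₀ with he
  -- Smoothness of `∇` is applied to a global smooth section; locality of `∇` then returns to the
  -- constant section near `x₀`.
  obtain ⟨σ, hσ, hσe⟩ := exists_contMDiff_eventuallyEq_constSection x₀ u
  obtain ⟨W, hWσ, hWo, hxW⟩ := eventually_nhds_iff.1 hσe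
  have hs := contMDiffOn_univ.1 (hcov.contMDiff.contMDiff (σ := σ) hσ.contMDiffOn)
  let h := trivializationAt (E →L[ℝ] E)
    (fun y : M => TangentSpace 𝓘(ℝ, E) y →L[ℝ] TangentSpace 𝓘(ℝ, E) y) x₀
  refine ⟨W ∩ e.baseSet, fun y => (h ⟨y, cov.toFun σ y⟩).2, hWo.inter e.open_baseSet,
    ⟨hxW, FiberBundle.mem_baseSet_trivializationAt' x₀⟩, inter_subset_right, ?_, ?_⟩
  · refine ((h.contMDiffOn_section_baseSet_iff).1 hs.contMDiffOn).mono ?_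
    intro y hy
    rw [hom_trivializationAt_baseSet]
    exact ⟨hy.2, hy.2⟩
  · intro y hy w
    have h1 : cov.toFun (constSection e u) y = cov.toFun σ y :=
      cov.isCovariantDerivativeOnUniv.congr_of_eventuallyEq
        (mdifferentiableAt_constSection e u hy.2) (hσ.mdifferentiable (by simp) y) univ_mem
        (by filter_upwards [hWo.mem_nhds hy.1] with z hz using (hWσ z hz).symm)
    rw [h1]
    simp only [h]
    rw [hom_trivializationAt_apply, ContinuousLinearMap.inCoordinates_eq hy.2 hy.2]
    change _ = (e ⟨y, cov.toFun σ y (e.symm y (e ⟨y, w⟩).2)⟩).2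
    rw [e.symm_apply_apply_mk hy.2]

/-- The Christoffel symbols of a smooth connection in the chart at `x₀`, as a smooth map with
values in bilinear maps on a ball around `x₀`. -/
lemma exists_contDiffOn_christoffel (cov : AffineConnection E M)
    [CovariantDerivative.ContMDiffCovariantDerivative cov ∞] (x₀ : M) :
    ∃ r > 0, ∃ Γ : E → E →L[ℝ] E →L[ℝ] E,
      Metric.ball (extChartAt 𝓘(ℝ, E) x₀ x₀) r ⊆ (extChartAt 𝓘(ℝ, E) x₀).target ∧
      ContDiffOn ℝ ∞ Γ (Metric.ball (extChartAt 𝓘(ℝ, E) x₀ x₀) r) ∧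
      ∀ y ∈ (extChartAt 𝓘(ℝ, E) x₀).source,
        extChartAt 𝓘(ℝ, E) x₀ y ∈ Metric.ball (extChartAt 𝓘(ℝ, E) x₀ x₀) r →
        ∀ (u : E) (w : TangentSpace 𝓘(ℝ, E) y),
        (trivializationAt E (TangentSpace 𝓘(ℝ, E) : M → Type _) x₀ ⟨y,
          cov.toFun (constSection (trivializationAt E _ x₀) u) y w⟩).2 =
        Γ (extChartAt 𝓘(ℝ, E) x₀ y) u
          (trivializationAt E (TangentSpace 𝓘(ℝ, E) : M → Type _) x₀ ⟨y, w⟩).2 := by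
  set e := trivializationAt E (TangentSpace 𝓘(ℝ, E) : M → Type _) x₀ with he
  set φ := extChartAt 𝓘(ℝ, E) x₀ with hφ
  -- Symbols are found for the finitely many basis vectors, on the intersection of their domains,
  -- and extended linearly in `u`.
  let b := Module.finBasis ℝ E
  choose W Γ hWo hxW hWe hΓ hΓe using fun i => exists_contMDiffOn_christoffel cov x₀ (b i)
  have hW : ⋂ i, W i ∈ 𝓝 x₀ := Filter.iInter_mem.2 fun i => (hWo i).mem_nhds (hxW i)
  have hpre : φ.symm ⁻¹' (⋂ i, W i) ∈ 𝓝 (φ x₀) :=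
    (continuousAt_extChartAt_symm x₀).preimage_mem_nhds (by simpa [hφ] using hW)
  obtain ⟨r, hr, hball⟩ := Metric.mem_nhds_iff.1
    (Filter.inter_mem hpre (extChartAt_target_mem_nhds (I := 𝓘(ℝ, E)) x₀))
  refine ⟨r, hr, fun z => ∑ i, (LinearMap.toContinuousLinearMap (b.coord i)).smulRight
    (Γ i (φ.symm z)), fun z hz => (hball hz).2, ?_, ?_⟩
  · refine ContDiffOn.sum fun i _ => ?_
    have h1 : ContDiffOn ℝ ∞ (fun z => Γ i (φ.symm z)) (Metric.ball (φ x₀) r) := by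
      rw [← contMDiffOn_iff_contDiffOn]
      refine (hΓ i).comp ((contMDiffOn_extChartAt_symm x₀).mono fun z hz => (hball hz).2) ?_
      exact fun z hz => mem_iInter.1 (hball hz).1 i
    exact contDiffOn_const.smulRight h1
  · intro y hys hyb u w
    have hyW : ∀ i, y ∈ W i := fun i => by
      have := mem_iInter.1 (hball hyb).1 i
      rwa [φ.left_inv hys] at this
    have hy : y ∈ e.baseSet := by
      simpa [hφ, he] using hys
    let L : E →ₗ[ℝ] E :=
      { toFun := fun u => (e ⟨y, cov.toFun (constSection e u) y w⟩).2
        map_add' := fun u v => by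
          rw [cov_constSection_add cov e hy, add_apply, snd_trivialization_add e hy]
        map_smul' := fun a u => by
          rw [cov_constSection_smul cov e hy, smul_apply, snd_trivialization_smul e hy]
          rfl }
    change L u = _
    conv_lhs => rw [← b.sum_repr u]
    rw [map_sum]
    simp only [sum_apply, ContinuousLinearMap.smulRight_apply, smul_apply]
    refine Finset.sum_congr rfl fun i _ => ?_
    rw [map_smul, φ.left_inv hys, ← hΓe i y (hyW i) w]
    rfl

end

/-! ### Linear differential equations with small coefficients. -/

noncomputable section

open Filter Topology

/-- **Picard-Lindelöf**: the solution stays in the ball on which the vector field is bounded. -/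
lemma IsPicardLindelof.exists_hasDerivWithinAt_mem_closedBall {E : Type*} [NormedAddCommGroup E]
    [NormedSpace ℝ E] [CompleteSpace E] {f : ℝ → E → E} {tmin tmax : ℝ} {t₀ : Icc tmin tmax}
    {x₀ x : E} {a r L K : NNReal} (hf : IsPicardLindelof f t₀ x₀ a r L K)
    (hx : x ∈ Metric.closedBall x₀ r) :
    ∃ α : ℝ → E, α t₀ = x ∧
      (∀ t ∈ Icc tmin tmax, HasDerivWithinAt α (f t (α t)) (Icc tmin tmax) t) ∧
      ∀ t, α t ∈ Metric.closedBall x₀ a := by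
  obtain ⟨α, hα⟩ := ODE.FunSpace.exists_isFixedPt_next hf hx
  refine ⟨α.compProj, by rw [ODE.FunSpace.compProj_val, ← hα, ODE.FunSpace.next_apply₀],
    fun t ht => ?_, fun t => α.compProj_mem_closedBall hf.mul_max_le⟩
  apply ODE.hasDerivWithinAt_picard_Icc t₀.2 hf.continuousOn_uncurry
    α.continuous_compProj.continuousOn (fun _ _ => α.compProj_mem_closedBall hf.mul_max_le) x ht
    |>.congr_of_mem _ ht
  intro t' ht'
  nth_rw 1 [← hα]
  rw [ODE.FunSpace.compProj_of_mem ht', ODE.FunSpace.next_apply]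

/-- Existence for a linear differential equation with small coefficients, with an estimate of the
solution at time `1` to first order. -/
lemma exists_linear_ode_solution {E : Type*} [NormedAddCommGroup E] [NormedSpace ℝ E]
    [CompleteSpace E] {A : ℝ → E →L[ℝ] E} (hA : ContinuousOn A (Icc 0 1)) {κ : ℝ}
    (hκ : κ ≤ 1 / 2) (hAκ : ∀ t ∈ Icc (0 : ℝ) 1, ‖A t‖ ≤ κ) (v : E) :
    ∃ g : ℝ → E, g 0 = v ∧ (∀ t ∈ Icc (0 : ℝ) 1, HasDerivWithinAt g (A t (g t)) (Icc 0 1) t) ∧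
      ∀ ε, (∀ t ∈ Icc (0 : ℝ) 1, ‖A t - A 0‖ ≤ ε) →
        ‖g 1 - v - A 0 v‖ ≤ (2 * ε + 2 * κ ^ 2) * ‖v‖ := by
  have h0 : (0 : ℝ) ∈ Icc (0 : ℝ) 1 := by simp
  have hκ0 : 0 ≤ κ := (norm_nonneg _).trans (hAκ 0 h0)
  have hball : ∀ x ∈ Metric.closedBall v ‖v‖₊, ‖x‖ ≤ 2 * ‖v‖ := fun x hx => by
    have h1 := norm_le_norm_add_norm_sub' x v
    have h2 : ‖x - v‖ ≤ ‖v‖ := by simpa [dist_eq_norm] using hx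
    linarith
  -- On the ball of radius `‖v‖` about `v` the speed is at most `κ * (2 * ‖v‖) ≤ ‖v‖`, so the
  -- solution exists for the whole unit time.
  have hpl : IsPicardLindelof (fun t x => A t x) (⟨0, h0⟩ : Icc (0 : ℝ) 1) v ‖v‖₊ 0 ‖v‖₊
      (NNReal.mk κ hκ0) := by
    refine ⟨fun t ht => ?_, fun x _ => hA.clm_apply continuousOn_const, fun t ht x hx => ?_, ?_⟩
    · exact ((A t).lipschitz.weaken (hAκ t ht)).lipschitzOnWith
    · refine ((A t).le_opNorm x).trans ?_
      have h1 := hball x hx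
      have h2 := hAκ t ht
      have := norm_nonneg x
      simp only [coe_nnnorm]
      nlinarith [norm_nonneg (A t)]
    · simp
  obtain ⟨α, hα0, hder, hαball⟩ :=
    hpl.exists_hasDerivWithinAt_mem_closedBall (Metric.mem_closedBall_self le_rfl)
  refine ⟨α, hα0, hder, fun ε hε => ?_⟩
  have hdist : ∀ t ∈ Icc (0 : ℝ) 1, ‖α t - v‖ ≤ 2 * κ * ‖v‖ := by
    intro t ht
    have h1 := (convex_Icc (0 : ℝ) 1).norm_image_sub_le_of_norm_hasDerivWithin_le (C := 2 * κ * ‖v‖)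
      hder (fun s hs => by
        refine ((A s).le_opNorm _).trans ?_
        have h1 := hball _ (hαball s)
        have h2 := hAκ s hs
        nlinarith [norm_nonneg (A s), norm_nonneg (α s)]) h0 ht
    rw [show α 0 = v from hα0] at h1
    refine h1.trans ?_
    have : ‖t - 0‖ ≤ 1 := by rw [sub_zero, Real.norm_eq_abs, abs_of_nonneg ht.1]; exact ht.2
    have h3 : 0 ≤ 2 * κ * ‖v‖ := by positivity
    nlinarith
  -- The mean value inequality, applied after subtracting the first-order solution, bounds the
  -- remainder.
  have hk : ∀ t ∈ Icc (0 : ℝ) 1, HasDerivWithinAt (fun t => α t - t • A 0 v)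
      (A t (α t) - A 0 v) (Icc 0 1) t := fun t ht => by
    exact ((hder t ht).sub ((hasDerivWithinAt_id t _).smul_const (A 0 v))).congr_deriv (by simp)
  have h1 := (convex_Icc (0 : ℝ) 1).norm_image_sub_le_of_norm_hasDerivWithin_le
    (C := (2 * ε + 2 * κ ^ 2) * ‖v‖) hk (fun t ht => by
      have e1 : A t (α t) - A 0 v =
          (A t - A 0) (α t) + A 0 (α t - v) := by simp
      rw [e1]
      refine (norm_add_le _ _).trans ?_
      have a1 := (A t - A 0).le_opNorm (α t)
      have a2 := (A 0).le_opNorm (α t - v)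
      have b1 := hball _ (hαball t)
      have b2 := hdist t ht
      have b3 := hε t ht
      have b4 := hAκ 0 h0
      have c1 : ‖A t - A 0‖ * ‖α t‖ ≤ ε * (2 * ‖v‖) :=
        mul_le_mul b3 b1 (norm_nonneg _) ((norm_nonneg _).trans b3)
      have c2 : ‖A 0‖ * ‖α t - v‖ ≤ κ * (2 * κ * ‖v‖) :=
        mul_le_mul b4 b2 (norm_nonneg _) hκ0
      nlinarith) h0 (right_mem_Icc.2 zero_le_one)
  simp only [show α 0 = v from hα0, one_smul, zero_smul, sub_zero, norm_one, mul_one] at h1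
  rwa [sub_right_comm] at h1

end

/-! ### Parallel transport in charts, reparametrization and concatenation. -/

noncomputable section

open Filter Topology

variable {E : Type*} [NormedAddCommGroup E] [NormedSpace ℝ E]
  {M : Type*} [TopologicalSpace M] [ChartedSpace E M] [IsManifold 𝓘(ℝ, E) ∞ M]

/-- `Γ` is the family of Christoffel symbols of `cov` in the chart at `x₀`, on the ball of radius `r`
around `x₀`, and it is smooth there. -/
structure IsChristoffel (cov : AffineConnection E M) (x₀ : M) (r : ℝ)
    (Γ : E → E →L[ℝ] E →L[ℝ] E) : Prop where
  ball_subset : Metric.ball (extChartAt 𝓘(ℝ, E) x₀ x₀) r ⊆ (extChartAt 𝓘(ℝ, E) x₀).target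
  contDiffOn : ContDiffOn ℝ ∞ Γ (Metric.ball (extChartAt 𝓘(ℝ, E) x₀ x₀) r)
  cov_constSection : ∀ y ∈ (extChartAt 𝓘(ℝ, E) x₀).source,
    extChartAt 𝓘(ℝ, E) x₀ y ∈ Metric.ball (extChartAt 𝓘(ℝ, E) x₀ x₀) r →
    ∀ (u : E) (w : TangentSpace 𝓘(ℝ, E) y),
    (trivializationAt E (TangentSpace 𝓘(ℝ, E) : M → Type _) x₀ ⟨y,
      cov.toFun (constSection (trivializationAt E _ x₀) u) y w⟩).2 =
    Γ (extChartAt 𝓘(ℝ, E) x₀ y) u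
      (trivializationAt E (TangentSpace 𝓘(ℝ, E) : M → Type _) x₀ ⟨y, w⟩).2

lemma snd_trivializationAt_eq_mfderiv (x₀ : M) {y : M}
    (hy : y ∈ (extChartAt 𝓘(ℝ, E) x₀).source) (w : TangentSpace 𝓘(ℝ, E) y) :
    (trivializationAt E (TangentSpace 𝓘(ℝ, E) : M → Type _) x₀ ⟨y, w⟩).2 =
      mvfderiv 𝓘(ℝ, E) (extChartAt 𝓘(ℝ, E) x₀) y w := by
  have hy' : y ∈ (chartAt E x₀).source := by simpa using hy
  have h := TangentBundle.continuousLinearMapAt_trivializationAt (I := 𝓘(ℝ, E)) (𝕜 := ℝ) hy'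
  rw [← (trivializationAt E (TangentSpace 𝓘(ℝ, E) : M → Type _) x₀).continuousLinearMapAt_apply_of_mem
    (R := ℝ) (by simpa using hy'), h]
  rfl

lemma snd_trivializationAt_mfderiv_curve (x₀ : M) {γ : ℝ → M} {t : ℝ}
    (hγ : MDifferentiableAt 𝓘(ℝ, ℝ) 𝓘(ℝ, E) γ t)
    (hy : γ t ∈ (extChartAt 𝓘(ℝ, E) x₀).source) :
    (trivializationAt E (TangentSpace 𝓘(ℝ, E) : M → Type _) x₀
      ⟨γ t, mfderiv 𝓘(ℝ, ℝ) 𝓘(ℝ, E) γ t (1 : ℝ)⟩).2 =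
      deriv (fun s => extChartAt 𝓘(ℝ, E) x₀ (γ s)) t := by
  rw [snd_trivializationAt_eq_mfderiv x₀ hy]
  have hφ : MDifferentiableAt 𝓘(ℝ, E) 𝓘(ℝ, E) (extChartAt 𝓘(ℝ, E) x₀) (γ t) :=
    mdifferentiableAt_extChartAt (by simpa using hy)
  refine (mfderiv_comp_apply t hφ hγ (1 : ℝ)).symm.trans ?_
  exact mvfderiv_real_apply_one (fun s => extChartAt 𝓘(ℝ, E) x₀ (γ s)) t

/-- The equation of parallel transport in a chart. -/
lemma IsChristoffel.covDerivAlong_eq_zero_iff [FiniteDimensional ℝ E] {cov : AffineConnection E M}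
    {x₀ : M} {r : ℝ} {Γ : E → E →L[ℝ] E →L[ℝ] E} (h : IsChristoffel cov x₀ r Γ)
    {c : ℝ → TangentBundle 𝓘(ℝ, E) M} {t : ℝ}
    (hc : MDifferentiableAt 𝓘(ℝ, ℝ) 𝓘(ℝ, E).tangent c t)
    (hy : (c t).proj ∈ (extChartAt 𝓘(ℝ, E) x₀).source)
    (hb : extChartAt 𝓘(ℝ, E) x₀ (c t).proj ∈ Metric.ball (extChartAt 𝓘(ℝ, E) x₀ x₀) r) :
    cov.covDerivAlong (fun s => (c s).proj) (fun s => (c s).snd) t = 0 ↔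
      deriv (fun s => (trivializationAt E (TangentSpace 𝓘(ℝ, E) : M → Type _) x₀ (c s)).2) t +
        Γ (extChartAt 𝓘(ℝ, E) x₀ (c t).proj)
          (trivializationAt E (TangentSpace 𝓘(ℝ, E) : M → Type _) x₀ (c t)).2
          (deriv (fun s => extChartAt 𝓘(ℝ, E) x₀ (c s).proj) t) = 0 := by
  have hγ : MDifferentiableAt 𝓘(ℝ, ℝ) 𝓘(ℝ, E) (fun s => (c s).proj) t :=
    ((mdifferentiableAt_totalSpace _ c).1 hc).1
  set e := trivializationAt E (TangentSpace 𝓘(ℝ, E) : M → Type _) x₀ with he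
  have hye : (c t).proj ∈ e.baseSet := by simpa [he] using hy
  rw [← snd_trivializationAt_mfderiv_curve x₀ hγ hy, ← h.cov_constSection _ hy hb,
    ← trivialization_covDerivAlong e cov hc hye, ← e.continuousLinearMapAt_apply_of_mem (R := ℝ) hye]
  constructor
  · intro h0
    rw [h0, map_zero]
  · intro h0
    rw [← e.symmL_continuousLinearMapAt (R := ℝ) hye
      (cov.covDerivAlong (fun s => (c s).proj) (fun s => (c s).snd) t), h0, map_zero]

namespace AffineConnection

/-- The curve `c` in the tangent bundle, viewed as a vector field along its projection, is
differentiable and parallel at time `t`. -/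
def IsParallelAt (cov : AffineConnection E M) (c : ℝ → TangentBundle 𝓘(ℝ, E) M) (t : ℝ) : Prop :=
  MDifferentiableAt 𝓘(ℝ, ℝ) 𝓘(ℝ, E).tangent c t ∧
    cov.covDerivAlong (fun s => (c s).proj) (fun s => (c s).snd) t = 0

/-- Parallel transport along some piecewise smooth curve takes `p` to `q`. -/
def Transports (cov : AffineConnection E M) (p q : TangentBundle 𝓘(ℝ, E) M) : Prop :=
  ∃ (P : Finset ℝ) (c : ℝ → TangentBundle 𝓘(ℝ, E) M),
    IsPiecewiseSmoothCurve E (fun t => (c t).proj) P ∧ ContinuousOn c (Icc 0 1) ∧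
    (∀ t ∈ Ioo (0 : ℝ) 1, t ∉ P → cov.IsParallelAt c t) ∧ c 0 = p ∧ c 1 = q

/-- `Transports` follows curves in the total space, so statements about loops and concatenations
need no casts between fibres. -/
lemma HasTrivialHolonomy.eq_of_transports {cov : AffineConnection E M}
    (h : cov.HasTrivialHolonomy) {p q : TangentBundle 𝓘(ℝ, E) M} (hpq : cov.Transports p q)
    (hproj : p.proj = q.proj) : q = p := by
  obtain ⟨P, c, hγ, hcont, hpar, rfl, rfl⟩ := hpq
  exact h (fun t => (c t).proj) hproj (c 0).snd (c 1).snd ⟨P, fun t => (c t).snd, hγ,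
    ⟨hcont, fun t ht htP => (hpar t ht htP).1, fun t ht htP => (hpar t ht htP).2⟩, rfl, rfl⟩

variable [FiniteDimensional ℝ E] [T2Space M]

lemma exists_isChristoffel (cov : AffineConnection E M)
    [CovariantDerivative.ContMDiffCovariantDerivative cov ∞] (x₀ : M) :
    ∃ r > 0, ∃ Γ, IsChristoffel cov x₀ r Γ := by
  obtain ⟨r, hr, Γ, h1, h2, h3⟩ := exists_contDiffOn_christoffel cov x₀
  exact ⟨r, hr, Γ, h1, h2, h3⟩

variable {cov : AffineConnection E M} [CovariantDerivative.ContMDiffCovariantDerivative cov ∞]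
  {c c' : ℝ → TangentBundle 𝓘(ℝ, E) M}

/-- The chart equation involves only the germ of non-dependent functions of the curve, unlike
`covDerivAlong` itself. -/
lemma IsParallelAt.congr_of_eventuallyEq {t : ℝ} (h : cov.IsParallelAt c t) (hcc : c' =ᶠ[𝓝 t] c) :
    cov.IsParallelAt c' t := by
  have hd : MDifferentiableAt 𝓘(ℝ, ℝ) 𝓘(ℝ, E).tangent c' t := h.1.congr_of_eventuallyEq hcc
  refine ⟨hd, ?_⟩
  obtain ⟨r, hr, Γ, hΓ⟩ := cov.exists_isChristoffel (c t).proj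
  have h2 := (hΓ.covDerivAlong_eq_zero_iff h.1 (mem_extChartAt_source _)
    (Metric.mem_ball_self hr)).1 h.2
  have ht : c' t = c t := hcc.eq_of_nhds
  refine (hΓ.covDerivAlong_eq_zero_iff hd (by rw [ht]; exact mem_extChartAt_source _)
    (by rw [ht]; exact Metric.mem_ball_self hr)).2 ?_
  have aux : ∀ f : TangentBundle 𝓘(ℝ, E) M → E, deriv (fun s => f (c' s)) t =
      deriv (fun s => f (c s)) t := fun f => (hcc.fun_comp f).deriv_eq
  rw [ht, aux fun p => (trivializationAt E (TangentSpace 𝓘(ℝ, E) : M → Type _) (c t).proj p).2,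
    aux fun p => extChartAt 𝓘(ℝ, E) (c t).proj p.proj]
  exact h2

/-- Each term of the chart equation is linear in the time derivative, so the reparametrization
multiplies the equation by `a`. -/
lemma IsParallelAt.comp_affine {a b t : ℝ} (h : cov.IsParallelAt c (a * t + b)) :
    cov.IsParallelAt (fun s => c (a * s + b)) t := by
  have hl : HasDerivAt (fun s => a * s + b) a t := by
    simpa using ((hasDerivAt_id t).const_mul a).add_const b
  have hd : MDifferentiableAt 𝓘(ℝ, ℝ) 𝓘(ℝ, E).tangent (fun s => c (a * s + b)) t :=
    h.1.comp t hl.differentiableAt.mdifferentiableAt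
  refine ⟨hd, ?_⟩
  obtain ⟨r, hr, Γ, hΓ⟩ := cov.exists_isChristoffel (c (a * t + b)).proj
  have h2 := (hΓ.covDerivAlong_eq_zero_iff h.1 (mem_extChartAt_source _)
    (Metric.mem_ball_self hr)).1 h.2
  refine (hΓ.covDerivAlong_eq_zero_iff hd (mem_extChartAt_source _) (Metric.mem_ball_self hr)).2 ?_
  have hh := (mdifferentiableAt_totalSpace _ c).1 h.1
  have h3 : MDifferentiableAt 𝓘(ℝ, ℝ) 𝓘(ℝ, E)
      (fun s => extChartAt 𝓘(ℝ, E) (c (a * t + b)).proj (c s).proj) (a * t + b) :=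
    (mdifferentiableAt_extChartAt (by simp)).comp _ hh.1
  have aux : ∀ f : ℝ → E, DifferentiableAt ℝ f (a * t + b) →
      deriv (fun s => f (a * s + b)) t = a • deriv f (a * t + b) := fun f hf =>
    (HasDerivAt.scomp t hf.hasDerivAt hl).deriv
  rw [aux (fun s => (trivializationAt E (TangentSpace 𝓘(ℝ, E) : M → Type _)
      (c (a * t + b)).proj (c s)).2) hh.2.differentiableAt,
    aux (fun s => extChartAt 𝓘(ℝ, E) (c (a * t + b)).proj (c s).proj) h3.differentiableAt,
    map_smul, ← smul_add, h2, smul_zero]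

lemma Transports.trans {p q s : TangentBundle 𝓘(ℝ, E) M} (hpq : cov.Transports p q)
    (hqs : cov.Transports q s) : cov.Transports p s := by
  obtain ⟨P₁, c₁, hγ₁, hcont₁, hpar₁, rfl, rfl⟩ := hpq
  obtain ⟨P₂, c₂, hγ₂, hcont₂, hpar₂, h0, rfl⟩ := hqs
  classical
  -- The junction `1 / 2` becomes a break point, so an interval without break points lies entirely
  -- in one half.
  let P : Finset ℝ := insert (1 / 2) (P₁.image (fun t => t / 2) ∪ P₂.image (fun t => (t + 1) / 2))
  let c : ℝ → TangentBundle 𝓘(ℝ, E) M := fun t =>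
    -- The `+ 0` and `+ -1` match the form `a * s + b` in `IsParallelAt.comp_affine`.
    if t ≤ 1 / 2 then c₁ (2 * t + 0) else c₂ (2 * t + -1)
  have hc₁ : ∀ t ≤ 1 / 2, c t = c₁ (2 * t + 0) := fun t ht => if_pos ht
  have hc₂ : ∀ t, 1 / 2 ≤ t → c t = c₂ (2 * t + -1) := fun t ht => by
    rcases ht.eq_or_lt with rfl | ht
    · rw [hc₁ _ le_rfl]
      norm_num [h0]
    · exact if_neg (not_le.2 ht)
  have hcont : ContinuousOn c (Icc 0 1) := by
    have h1 : ContinuousOn c (Icc 0 (1 / 2)) := by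
      refine (hcont₁.comp (f := fun t => 2 * t + 0) (by fun_prop) fun t ht => ?_).congr
        fun t ht => hc₁ t ht.2
      constructor <;> linarith [ht.1, ht.2]
    have h2 : ContinuousOn c (Icc (1 / 2) 1) := by
      refine (hcont₂.comp (f := fun t => 2 * t + -1) (by fun_prop) fun t ht => ?_).congr
        fun t ht => hc₂ t ht.1
      constructor <;> linarith [ht.1, ht.2]
    rw [← Icc_union_Icc_eq_Icc (show (0 : ℝ) ≤ 1 / 2 by norm_num) (by norm_num)]
    exact h1.union_of_isClosed h2 isClosed_Icc isClosed_Icc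
  have haff : ∀ b : ℝ, ContMDiff 𝓘(ℝ, ℝ) 𝓘(ℝ, ℝ) ∞ (fun t : ℝ => 2 * t + b) := fun b =>
    ContDiff.contMDiff (by fun_prop)
  refine ⟨P, c, ⟨?_, ?_⟩, hcont, ?_, ?_, ?_⟩
  · exact (FiberBundle.continuous_proj E _).comp_continuousOn hcont
  · intro a b ha hab hb hP
    have hP0 : (1 / 2 : ℝ) ∉ Ioo a b := hP _ (by simp [P])
    by_cases hb2 : b ≤ 1 / 2
    · have hs := (hγ₁.contMDiffOn (2 * a + 0) (2 * b + 0) (by linarith) (by linarith) (by linarith)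
        fun p hp hpi => hP (p / 2) (by simp [P]; tauto)
          ⟨by linarith [hpi.1], by linarith [hpi.2]⟩)
      refine (hs.comp (haff 0).contMDiffOn fun t ht => ?_).congr fun t ht => ?_
      · constructor <;> linarith [ht.1, ht.2]
      · simp only [Function.comp, hc₁ t (ht.2.trans hb2)]
    · have ha2 : 1 / 2 ≤ a := by
        by_contra hlt
        exact hP0 ⟨not_le.1 hlt, not_le.1 hb2⟩
      have hs := (hγ₂.contMDiffOn (2 * a + -1) (2 * b + -1) (by linarith) (by linarith)
        (by linarith) fun p hp hpi => hP ((p + 1) / 2) (by simp [P]; tauto)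
          ⟨by linarith [hpi.1], by linarith [hpi.2]⟩)
      refine (hs.comp (haff (-1)).contMDiffOn fun t ht => ?_).congr fun t ht => ?_
      · constructor <;> linarith [ht.1, ht.2]
      · simp only [Function.comp, hc₂ t (ha2.trans ht.1)]
  · intro t ht htP
    have hne : t ≠ 1 / 2 := fun h => htP (by simp [P, h])
    rcases lt_or_gt_of_ne hne with hlt | hgt
    · have h1 : cov.IsParallelAt c₁ (2 * t + 0) :=
        hpar₁ _ ⟨by linarith [ht.1], by linarith⟩ fun h => htP (by
          simp only [P, Finset.mem_insert, Finset.mem_union, Finset.mem_image]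
          exact Or.inr (Or.inl ⟨_, h, by ring⟩))
      refine h1.comp_affine.congr_of_eventuallyEq ?_
      filter_upwards [Iio_mem_nhds hlt] with s hs using hc₁ s (le_of_lt hs)
    · have h1 : cov.IsParallelAt c₂ (2 * t + -1) :=
        hpar₂ _ ⟨by linarith, by linarith [ht.2]⟩ fun h => htP (by
          simp only [P, Finset.mem_insert, Finset.mem_union, Finset.mem_image]
          exact Or.inr (Or.inr ⟨_, h, by ring⟩))
      refine h1.comp_affine.congr_of_eventuallyEq ?_
      filter_upwards [Ioi_mem_nhds hgt] with s hs using hc₂ s (le_of_lt hs)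
  · rw [hc₁ _ (by norm_num)]
    norm_num
  · rw [hc₂ _ (by norm_num)]
    norm_num

end AffineConnection
end

/-! ### Transport along segments of a chart. -/

noncomputable section

open Filter Topology

variable {E : Type*} [NormedAddCommGroup E] [NormedSpace ℝ E]
  {M : Type*} [TopologicalSpace M] [ChartedSpace E M] [IsManifold 𝓘(ℝ, E) ∞ M]

/-- The tangent vector with coordinates `(z, u)` in the chart at `x₀`. -/
def chartVector (x₀ : M) (z u : E) : TangentBundle 𝓘(ℝ, E) M :=
  ⟨(extChartAt 𝓘(ℝ, E) x₀).symm z,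
    constSection (trivializationAt E _ x₀) u ((extChartAt 𝓘(ℝ, E) x₀).symm z)⟩

lemma chartVector_extChartAt (x₀ : M) (p : TangentBundle 𝓘(ℝ, E) M)
    (hp : p.proj ∈ (extChartAt 𝓘(ℝ, E) x₀).source) :
    chartVector x₀ (extChartAt 𝓘(ℝ, E) x₀ p.proj)
      (trivializationAt E (TangentSpace 𝓘(ℝ, E) : M → Type _) x₀ p).2 = p := by
  have hb : p.proj ∈ (trivializationAt E (TangentSpace 𝓘(ℝ, E) : M → Type _) x₀).baseSet := by
    simpa using hp
  rw [chartVector, (extChartAt 𝓘(ℝ, E) x₀).left_inv hp, constSection,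
    (trivializationAt E (TangentSpace 𝓘(ℝ, E) : M → Type _) x₀).symm_proj_apply p hb]

lemma trivializationAt_chartVector (x₀ : M) {z : E} (hz : z ∈ (extChartAt 𝓘(ℝ, E) x₀).target)
    (u : E) : trivializationAt E (TangentSpace 𝓘(ℝ, E) : M → Type _) x₀ (chartVector x₀ z u) =
      ((extChartAt 𝓘(ℝ, E) x₀).symm z, u) := by
  have h := (extChartAt 𝓘(ℝ, E) x₀).map_target hz
  exact trivialization_constSection _ u (by simpa using h)

lemma IsChristoffel.mono {cov : AffineConnection E M} {x₀ : M} {r ρ : ℝ}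
    {Γ : E → E →L[ℝ] E →L[ℝ] E} (h : IsChristoffel cov x₀ r Γ) (hρ : ρ ≤ r) :
    IsChristoffel cov x₀ ρ Γ where
  ball_subset := (Metric.ball_subset_ball hρ).trans h.ball_subset
  contDiffOn := h.contDiffOn.mono (Metric.ball_subset_ball hρ)
  cov_constSection := fun y hy hb => h.cov_constSection y hy (Metric.ball_subset_ball hρ hb)

variable [FiniteDimensional ℝ E]

/-- Along the straight segment from `a` to `b` the equation is `g' = -Γ z g (b - a)`, linear in `g`
with coefficient of norm at most `C * ‖b - a‖ ≤ 1 / 2`. The estimate to first order in `b - a` later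
yields the derivative of an invariant section. -/
lemma IsChristoffel.exists_transports {cov : AffineConnection E M}
    {x₀ : M} {r C : ℝ} {Γ : E → E →L[ℝ] E →L[ℝ] E} (h : IsChristoffel cov x₀ r Γ)
    (hC : ∀ z ∈ Metric.ball (extChartAt 𝓘(ℝ, E) x₀ x₀) r, ‖Γ z‖ ≤ C) {a b : E}
    (ha : a ∈ Metric.ball (extChartAt 𝓘(ℝ, E) x₀ x₀) r)
    (hb : b ∈ Metric.ball (extChartAt 𝓘(ℝ, E) x₀ x₀) r) (hab : C * ‖b - a‖ ≤ 1 / 2) (v : E) :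
    ∃ w, cov.Transports (chartVector x₀ a v) (chartVector x₀ b w) ∧
      ∀ ε, (∀ z ∈ segment ℝ a b, ‖Γ z - Γ a‖ ≤ ε) →
        ‖w - v + Γ a v (b - a)‖ ≤ (2 * (ε * ‖b - a‖) + 2 * (C * ‖b - a‖) ^ 2) * ‖v‖ := by
  set e := trivializationAt E (TangentSpace 𝓘(ℝ, E) : M → Type _) x₀ with he
  set φ := extChartAt 𝓘(ℝ, E) x₀ with hφ
  let z : ℝ → E := fun t => a + t • (b - a)
  have hzseg : ∀ t ∈ Icc (0 : ℝ) 1, z t ∈ segment ℝ a b := fun t ht => by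
    rw [segment_eq_image']
    exact ⟨t, ht, rfl⟩
  have hzb : ∀ t ∈ Icc (0 : ℝ) 1, z t ∈ Metric.ball (φ x₀) r := fun t ht =>
    (convex_ball _ _).segment_subset ha hb (hzseg t ht)
  have hzd : ∀ t, HasDerivAt z (b - a) t := fun t => by
    simpa [z] using ((hasDerivAt_id t).smul_const (b - a)).const_add a
  have hzs : ContDiff ℝ ∞ z := by fun_prop
  let A : ℝ → E →L[ℝ] E := fun t => -(Γ (z t)).flip (b - a)
  have hA : ContinuousOn A (Icc 0 1) := by
    have h1 : ContinuousOn (fun t => Γ (z t)) (Icc 0 1) :=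
      h.contDiffOn.continuousOn.comp hzs.continuous.continuousOn hzb
    have h2 : ContinuousOn (fun t => (Γ (z t)).flip) (Icc 0 1) :=
      (ContinuousLinearMap.flipₗᵢ ℝ E E E).continuous.comp_continuousOn h1
    exact (h2.clm_apply continuousOn_const).neg
  have hflip : ∀ B : E →L[ℝ] E →L[ℝ] E, ‖B.flip (b - a)‖ ≤ ‖B‖ * ‖b - a‖ := fun B => by
    simpa using B.flip.le_opNorm (b - a)
  have hAC : ∀ t ∈ Icc (0 : ℝ) 1, ‖A t‖ ≤ C * ‖b - a‖ := fun t ht => by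
    simp only [A, norm_neg]
    exact (hflip _).trans (mul_le_mul_of_nonneg_right (hC _ (hzb t ht)) (norm_nonneg _))
  obtain ⟨g, hg0, hgd, hgε⟩ := exists_linear_ode_solution hA hab hAC v
  have hz0 : z 0 = a := by simp [z]
  have hz1 : z 1 = b := by simp [z]
  refine ⟨g 1, ⟨∅, fun t => chartVector x₀ (z t) (g t), ?_, ?_, ?_, ?_, ?_⟩, ?_⟩
  · have hs : ContMDiffOn 𝓘(ℝ, ℝ) 𝓘(ℝ, E) ∞ (fun t => φ.symm (z t)) (Icc 0 1) :=
      (contMDiffOn_extChartAt_symm x₀).comp hzs.contMDiff.contMDiffOn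
        fun t ht => h.ball_subset (hzb t ht)
    exact ⟨hs.continuousOn, fun s t hs0 _ ht1 _ => hs.mono (Icc_subset_Icc hs0 ht1)⟩
  · have hgc : ContinuousOn g (Icc 0 1) := fun t ht => (hgd t ht).continuousWithinAt
    have h1 : ContinuousOn (fun t => (φ.symm (z t), g t)) (Icc 0 1) :=
      ((continuousOn_extChartAt_symm x₀).comp hzs.continuous.continuousOn
        fun t ht => h.ball_subset (hzb t ht)).prodMk hgc
    have hm : ∀ t ∈ Icc (0 : ℝ) 1, φ.symm (z t) ∈ e.baseSet := fun t ht => by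
      simpa [hφ, he] using φ.map_target (h.ball_subset (hzb t ht))
    refine (e.continuousOn_symm.comp h1 fun t ht => e.mk_mem_target.2 (hm t ht)).congr
      fun t _ => rfl
  · intro t ht _
    have hnhds : Icc (0 : ℝ) 1 ∈ 𝓝 t := Icc_mem_nhds ht.1 ht.2
    have ht' := Ioo_subset_Icc_self ht
    have hzt := hzb t ht'
    have hgt : HasDerivAt g (A t (g t)) t := (hgd t ht').hasDerivAt hnhds
    have hsrc : φ.symm (z t) ∈ φ.source := φ.map_target (h.ball_subset hzt)
    have heq : (fun s => (e (chartVector x₀ (z s) (g s))).2) =ᶠ[𝓝 t] g := by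
      filter_upwards [hnhds] with s hs
      rw [trivializationAt_chartVector x₀ (h.ball_subset (hzb s hs))]
    have hφz : (fun s => φ (chartVector x₀ (z s) (g s)).proj) =ᶠ[𝓝 t] z := by
      filter_upwards [hnhds] with s hs
      exact φ.right_inv (h.ball_subset (hzb s hs))
    have hd : MDifferentiableAt 𝓘(ℝ, ℝ) 𝓘(ℝ, E).tangent
        (fun s => chartVector x₀ (z s) (g s)) t := by
      refine (e.mdifferentiableAt_totalSpace_iff 𝓘(ℝ, E) _ ?_).2 ⟨?_, ?_⟩
      · rw [e.mem_source]
        change φ.symm (z t) ∈ e.baseSet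
        simpa [hφ, he] using hsrc
      · have h1 : ContMDiffAt 𝓘(ℝ, E) 𝓘(ℝ, E) ∞ φ.symm (z t) :=
          (contMDiffOn_extChartAt_symm x₀).contMDiffAt
            ((isOpen_extChartAt_target x₀).mem_nhds (h.ball_subset hzt))
        exact (h1.mdifferentiableAt (by simp)).comp t (hzd t).differentiableAt.mdifferentiableAt
      · exact (hgt.differentiableAt.mdifferentiableAt).congr_of_eventuallyEq heq
    refine ⟨hd, (h.covDerivAlong_eq_zero_iff hd hsrc ?_).2 ?_⟩
    · rwa [show φ (chartVector x₀ (z t) (g t)).proj = z t from hφz.eq_of_nhds]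
    · rw [show φ (chartVector x₀ (z t) (g t)).proj = z t from hφz.eq_of_nhds, heq.deriv_eq,
        hφz.deriv_eq, (hzd t).deriv, hgt.deriv,
        show (e (chartVector x₀ (z t) (g t))).2 = g t from heq.eq_of_nhds]
      simp [A]
  · change chartVector x₀ (z 0) (g 0) = _
    rw [hz0, hg0]
  · change chartVector x₀ (z 1) (g 1) = _
    rw [hz1]
  · intro ε hε
    have h1 := hgε (ε * ‖b - a‖) fun t ht => by
      have e1 : A t - A 0 = -((Γ (z t) - Γ a).flip (b - a)) := by
        ext u
        simp [A, hz0]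
        abel
      rw [e1, norm_neg]
      exact (hflip _).trans (mul_le_mul_of_nonneg_right (hε _ (hzseg t ht)) (norm_nonneg _))
    have e2 : A 0 v = -Γ a v (b - a) := by simp only [A, hz0]; rfl
    rwa [e2, sub_neg_eq_add] at h1

end

/-! ### From trivial holonomy to parallel vector fields. -/

noncomputable section

open Filter Topology

/-- A differentiable solution of `df = F(x, f)` with smooth `F` linear in `f` is smooth. -/
lemma contDiffOn_of_hasFDerivAt_linear {E : Type*} [NormedAddCommGroup E] [NormedSpace ℝ E]
    {s : Set E} (hs : IsOpen s) {f : E → E} {Γ : E → E →L[ℝ] E →L[ℝ] E}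
    (hΓ : ContDiffOn ℝ ∞ Γ s) (hf : ∀ a ∈ s, HasFDerivAt f (-(Γ a (f a))) a) :
    ContDiffOn ℝ ∞ f s := by
  rw [contDiffOn_infty]
  intro n
  induction n with
  | zero =>
    exact contDiffOn_zero.2 fun a ha => (hf a ha).continuousAt.continuousWithinAt
  | succ n ih =>
    refine (contDiffOn_succ_iff_fderiv_of_isOpen hs).2
      ⟨fun a ha => (hf a ha).differentiableAt.differentiableWithinAt,
        fun h => absurd h (WithTop.natCast_ne_top (α := ℕ∞) n), ?_⟩
    have h1 : ContDiffOn ℝ n (fun a => -(Γ a (f a))) s :=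
      ((hΓ.of_le (by exact_mod_cast le_top)).clm_apply ih).neg
    exact h1.congr fun a ha => (hf a ha).fderiv

lemma ContinuousOn.eventually_norm_sub_lt {E G : Type*} [NormedAddCommGroup E]
    [NormedAddCommGroup G] {f : E → G} {s : Set E} {a : E} (hf : ContinuousOn f s) (hs : s ∈ 𝓝 a)
    {ε : ℝ} (hε : 0 < ε) : ∀ᶠ z in 𝓝 a, ‖f z - f a‖ < ε := by
  simpa [dist_eq_norm] using Metric.continuousAt_iff'.1 (hf.continuousAt hs) ε hε

variable {E : Type*} [NormedAddCommGroup E] [NormedSpace ℝ E] [FiniteDimensional ℝ E]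
  {M : Type*} [TopologicalSpace M] [ChartedSpace E M] [IsManifold 𝓘(ℝ, E) ∞ M]

set_option synthInstance.maxHeartbeats 200000 in
/-- A section invariant under parallel transport satisfies `dX = -Γ(·, X)` in a chart. -/
lemma IsChristoffel.hasFDerivAt_of_invariant {cov : AffineConnection E M}
    {x₀ : M} {r C : ℝ} {Γ : E → E →L[ℝ] E →L[ℝ] E} (h : IsChristoffel cov x₀ r Γ)
    (hC : ∀ z ∈ Metric.ball (extChartAt 𝓘(ℝ, E) x₀ x₀) r, ‖Γ z‖ ≤ C)
    (hC2 : ∀ a ∈ Metric.ball (extChartAt 𝓘(ℝ, E) x₀ x₀) r,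
      ∀ b ∈ Metric.ball (extChartAt 𝓘(ℝ, E) x₀ x₀) r, C * ‖b - a‖ ≤ 1 / 2)
    {X : ∀ y : M, TangentSpace 𝓘(ℝ, E) y}
    (hX : ∀ (y : M) (q : TangentBundle 𝓘(ℝ, E) M),
      cov.Transports ⟨y, X y⟩ q → q = ⟨q.proj, X q.proj⟩)
    {f : E → E} (hf : ∀ a, f a = (trivializationAt E (TangentSpace 𝓘(ℝ, E) : M → Type _) x₀
      ⟨(extChartAt 𝓘(ℝ, E) x₀).symm a, X ((extChartAt 𝓘(ℝ, E) x₀).symm a)⟩).2)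
    {a : E} (ha : a ∈ Metric.ball (extChartAt 𝓘(ℝ, E) x₀ x₀) r) :
    HasFDerivAt f (-(Γ a (f a))) a := by
  have hfv : ∀ b ∈ Metric.ball (extChartAt 𝓘(ℝ, E) x₀ x₀) r, chartVector x₀ b (f b) =
      ⟨(extChartAt 𝓘(ℝ, E) x₀).symm b, X ((extChartAt 𝓘(ℝ, E) x₀).symm b)⟩ := fun b hb => by
    have ht := h.ball_subset hb
    have h1 := chartVector_extChartAt x₀ (⟨(extChartAt 𝓘(ℝ, E) x₀).symm b,
      X ((extChartAt 𝓘(ℝ, E) x₀).symm b)⟩ : TangentBundle 𝓘(ℝ, E) M)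
      ((extChartAt 𝓘(ℝ, E) x₀).map_target ht)
    rwa [(extChartAt 𝓘(ℝ, E) x₀).right_inv ht, ← hf] at h1
  -- Invariance identifies the transported vector `w` with `f b`, turning the transport estimate
  -- into a first-order expansion of `f`.
  have key : ∀ b ∈ Metric.ball (extChartAt 𝓘(ℝ, E) x₀ x₀) r, ∀ ε,
      (∀ z ∈ segment ℝ a b, ‖Γ z - Γ a‖ ≤ ε) →
      ‖f b - f a + Γ a (f a) (b - a)‖ ≤
        (2 * (ε * ‖b - a‖) + 2 * (C * ‖b - a‖) ^ 2) * ‖f a‖ := by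
    intro b hb
    obtain ⟨w, hw, hε⟩ := h.exists_transports hC ha hb (hC2 a ha b hb) (f a)
    rw [hfv a ha] at hw
    have h1 := hX _ _ hw
    have h2 : chartVector x₀ b w = chartVector x₀ b (f b) := h1.trans (hfv b hb).symm
    have h3 := congrArg (fun p => (trivializationAt E (TangentSpace 𝓘(ℝ, E) : M → Type _) x₀ p).2) h2
    simp only [trivializationAt_chartVector x₀ (h.ball_subset hb)] at h3
    rwa [h3] at hε
  rw [hasFDerivAt_iff_isLittleO, Asymptotics.isLittleO_iff]
  intro c hc
  have hball : Metric.ball (extChartAt 𝓘(ℝ, E) x₀ x₀) r ∈ 𝓝 a := Metric.isOpen_ball.mem_nhds ha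
  -- This gives `2 * ε * ‖f a‖ ≤ c / 2`, with `+ 1` covering `f a = 0`; the quadratic term uses the
  -- other half of `c`.
  set ε := c / (4 * (‖f a‖ + 1)) with hε
  have hε0 : 0 < ε := by positivity
  have hΓε : ∀ᶠ z in 𝓝 a, ‖Γ z - Γ a‖ < ε :=
    h.contDiffOn.continuousOn.eventually_norm_sub_lt hball hε0
  obtain ⟨δ, hδ, hδb⟩ := Metric.eventually_nhds_iff_ball.1 hΓε
  have hsmall : ∀ᶠ b in 𝓝 a, 2 * C ^ 2 * ‖b - a‖ * ‖f a‖ < c / 2 := by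
    have : ContinuousAt (fun b => 2 * C ^ 2 * ‖b - a‖ * ‖f a‖) a := by fun_prop
    exact this.eventually (gt_mem_nhds (by simp [hc]))
  filter_upwards [hball, Metric.ball_mem_nhds a hδ, hsmall] with b hb hbδ hbs
  have h1 := key b hb ε fun z hz =>
    (hδb z ((convex_ball a δ).segment_subset (Metric.mem_ball_self hδ) hbδ hz)).le
  rw [neg_apply, sub_neg_eq_add]
  refine h1.trans ?_
  have h2 : 2 * ε * ‖f a‖ ≤ c / 2 := by
    have h3 : ε * (4 * (‖f a‖ + 1)) = c := by rw [hε]; field_simp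
    nlinarith
  have h4 := norm_nonneg (b - a)
  nlinarith [mul_le_mul_of_nonneg_right h2 h4, mul_le_mul_of_nonneg_right hbs.le h4]

variable [T2Space M]

namespace AffineConnection

set_option synthInstance.maxHeartbeats 200000 in
-- Continuity at the centre gives the bound `C = ‖Γ z₀‖ + 1` nearby, and radius at most `1 / (4 *
-- C)` keeps any two points within `1 / (2 * C)`.
lemma exists_isChristoffel_bounded (cov : AffineConnection E M)
    [CovariantDerivative.ContMDiffCovariantDerivative cov ∞] (x₀ : M) :
    ∃ r > 0, ∃ Γ C, IsChristoffel cov x₀ r Γ ∧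
      (∀ z ∈ Metric.ball (extChartAt 𝓘(ℝ, E) x₀ x₀) r, ‖Γ z‖ ≤ C) ∧
      ∀ a ∈ Metric.ball (extChartAt 𝓘(ℝ, E) x₀ x₀) r,
      ∀ b ∈ Metric.ball (extChartAt 𝓘(ℝ, E) x₀ x₀) r, C * ‖b - a‖ ≤ 1 / 2 := by
  obtain ⟨r, hr, Γ, hΓ⟩ := cov.exists_isChristoffel x₀
  set z₀ := extChartAt 𝓘(ℝ, E) x₀ x₀
  set C := ‖Γ z₀‖ + 1
  have hC : 0 < C := by positivity
  have h1 : ∀ᶠ z in 𝓝 z₀, ‖Γ z - Γ z₀‖ < 1 :=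
    hΓ.contDiffOn.continuousOn.eventually_norm_sub_lt (Metric.ball_mem_nhds _ hr) one_pos
  obtain ⟨δ, hδ, hball⟩ := Metric.eventually_nhds_iff_ball.1 h1
  refine ⟨min r (min δ (1 / (4 * C))), by positivity, Γ, C, hΓ.mono (min_le_left _ _), ?_, ?_⟩
  · intro z hz
    have h2 := hball z (Metric.ball_subset_ball ((min_le_right _ _).trans (min_le_left _ _)) hz)
    linarith [norm_le_norm_add_norm_sub' (Γ z) (Γ z₀)]
  · intro a ha b hb
    have ha' := Metric.ball_subset_ball ((min_le_right _ _).trans (min_le_right _ _)) ha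
    have hb' := Metric.ball_subset_ball ((min_le_right _ _).trans (min_le_right _ _)) hb
    have h2 : ‖b - a‖ ≤ 1 / (2 * C) := by
      rw [← dist_eq_norm]
      rw [Metric.mem_ball] at ha' hb'
      have h3 := dist_triangle_right b a z₀
      have h4 : 1 / (2 * C) = 1 / (4 * C) + 1 / (4 * C) := by field_simp; norm_num
      linarith
    calc C * ‖b - a‖ ≤ C * (1 / (2 * C)) := by gcongr
      _ = 1 / 2 := by field_simp

lemma exists_open_transports (cov : AffineConnection E M)
    [CovariantDerivative.ContMDiffCovariantDerivative cov ∞] (x₀ : M) :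
    ∃ U : Set M, IsOpen U ∧ x₀ ∈ U ∧ ∀ p : TangentBundle 𝓘(ℝ, E) M, p.proj ∈ U → ∀ y ∈ U,
      ∃ v : TangentSpace 𝓘(ℝ, E) y, cov.Transports p ⟨y, v⟩ := by
  obtain ⟨r, hr, Γ, C, hΓ, hC, hC2⟩ := cov.exists_isChristoffel_bounded x₀
  refine ⟨(extChartAt 𝓘(ℝ, E) x₀).source ∩
    extChartAt 𝓘(ℝ, E) x₀ ⁻¹' Metric.ball (extChartAt 𝓘(ℝ, E) x₀ x₀) r,
    (continuousOn_extChartAt x₀).isOpen_inter_preimage (isOpen_extChartAt_source x₀)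
      Metric.isOpen_ball, ⟨mem_extChartAt_source x₀, Metric.mem_ball_self hr⟩, ?_⟩
  intro p hp y hy
  obtain ⟨w, hw, -⟩ := hΓ.exists_transports hC hp.2 hy.2 (hC2 _ hp.2 _ hy.2)
    (trivializationAt E (TangentSpace 𝓘(ℝ, E) : M → Type _) x₀ p).2
  rw [chartVector_extChartAt x₀ p hp.1, chartVector, (extChartAt 𝓘(ℝ, E) x₀).left_inv hy.1] at hw
  exact ⟨_, hw⟩

/-- Every point has a neighbourhood in which any two points are joined by transport, so the set of
reachable points is open and closed. -/
lemma exists_transports [ConnectedSpace M] (cov : AffineConnection E M)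
    [CovariantDerivative.ContMDiffCovariantDerivative cov ∞] (p : TangentBundle 𝓘(ℝ, E) M) (y : M) :
    ∃ v : TangentSpace 𝓘(ℝ, E) y, cov.Transports p ⟨y, v⟩ := by
  choose U hUo hxU hU using cov.exists_open_transports
  let R : Set M := {y | ∃ v : TangentSpace 𝓘(ℝ, E) y, cov.Transports p ⟨y, v⟩}
  have hmem : ∀ x, ∀ y ∈ U x, ∀ z ∈ U x, y ∈ R → z ∈ R := fun x y hy z hz ⟨v, hv⟩ =>
    let ⟨w, hw⟩ := hU x ⟨y, v⟩ hy z hz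
    ⟨w, hv.trans hw⟩
  have hclopen : IsClopen R := by
    refine ⟨isClosed_of_closure_subset fun x hx => ?_, isOpen_iff_mem_nhds.2 fun x hx => ?_⟩
    · obtain ⟨y, hyU, hyR⟩ := mem_closure_iff.1 hx (U x) (hUo x) (hxU x)
      exact hmem x y hyU x (hxU x) hyR
    · filter_upwards [(hUo x).mem_nhds (hxU x)] with z hz using hmem x x (hxU x) z hz hx
  have hne : R.Nonempty := ⟨p.proj, hU p.proj p (hxU _) p.proj (hxU _)⟩
  exact eq_univ_iff_forall.1 (hclopen.eq_univ hne) y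

/-- If the holonomy is trivial, every tangent vector spreads to a section that is invariant under
parallel transport. -/
lemma HasTrivialHolonomy.exists_invariant_section [ConnectedSpace M] {cov : AffineConnection E M}
    [CovariantDerivative.ContMDiffCovariantDerivative cov ∞] (h : cov.HasTrivialHolonomy)
    (p : TangentBundle 𝓘(ℝ, E) M) :
    ∃ X : ∀ y : M, TangentSpace 𝓘(ℝ, E) y, (⟨p.proj, X p.proj⟩ : TangentBundle 𝓘(ℝ, E) M) = p ∧
      ∀ (y : M) (q : TangentBundle 𝓘(ℝ, E) M), cov.Transports ⟨y, X y⟩ q → q = ⟨q.proj, X q.proj⟩ := by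
  choose X hX using cov.exists_transports p
  have huniq : ∀ q, cov.Transports p q → q = ⟨q.proj, X q.proj⟩ := fun q hq => by
    -- Transporting `q` back over the base point of `p` closes a loop, so it returns `p`. Going on
    -- to `X q.proj` closes a loop at `q.proj`, forcing `X q.proj = q`. No curve is reversed.
    obtain ⟨v, hv⟩ := cov.exists_transports q p.proj
    have h1 := h.eq_of_transports (hq.trans hv) rfl
    rw [h1] at hv
    exact (h.eq_of_transports (hv.trans (hX q.proj)) rfl).symm
  exact ⟨X, h.eq_of_transports (hX p.proj) rfl, fun y q hq => huniq q ((hX y).trans hq)⟩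

/-- If the holonomy is trivial, every tangent vector extends to a parallel vector field. -/
theorem HasTrivialHolonomy.exists_parallelField [ConnectedSpace M] {cov : AffineConnection E M}
    [CovariantDerivative.ContMDiffCovariantDerivative cov ∞] (h : cov.HasTrivialHolonomy)
    (x : M) (v : TangentSpace 𝓘(ℝ, E) x) : ∃ X ∈ cov.parallelFields, X x = v := by
  obtain ⟨X, hXv, hX⟩ := h.exists_invariant_section ⟨x, v⟩
  have key : ∀ x₀ : M, ContMDiffAt 𝓘(ℝ, E) (𝓘(ℝ, E).prod 𝓘(ℝ, E)) ∞
      (fun z => (⟨z, X z⟩ : TangentBundle 𝓘(ℝ, E) M)) x₀ ∧ cov.toFun X x₀ = 0 := by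
    intro x₀
    obtain ⟨r, hr, Γ, C, hΓ, hC, hC2⟩ := cov.exists_isChristoffel_bounded x₀
    set e := trivializationAt E (TangentSpace 𝓘(ℝ, E) : M → Type _) x₀ with he
    set φ := extChartAt 𝓘(ℝ, E) x₀ with hφ
    have hb : x₀ ∈ e.baseSet := FiberBundle.mem_baseSet_trivializationAt' x₀
    obtain ⟨f, hf⟩ : ∃ f : E → E, ∀ a, f a = (e ⟨φ.symm a, X (φ.symm a)⟩).2 := ⟨_, fun _ => rfl⟩
    have hfd := fun a ha => hΓ.hasFDerivAt_of_invariant hC hC2 hX hf (a := a) ha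
    have hfs := contDiffOn_of_hasFDerivAt_linear Metric.isOpen_ball hΓ.contDiffOn hfd
    have hfat : ContDiffAt ℝ ∞ f (φ x₀) := hfs.contDiffAt (Metric.ball_mem_nhds _ hr)
    have hφat : ContMDiffAt 𝓘(ℝ, E) 𝓘(ℝ, E) ∞ φ x₀ := contMDiffAt_extChartAt
    have heq : (fun z => (e ⟨z, X z⟩).2) =ᶠ[𝓝 x₀] f ∘ φ := by
      filter_upwards [extChartAt_source_mem_nhds (I := 𝓘(ℝ, E)) x₀] with z hz
      simp only [Function.comp, hf]
      rw [φ.left_inv hz]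
    have hXs : ContMDiffAt 𝓘(ℝ, E) (𝓘(ℝ, E).prod 𝓘(ℝ, E)) ∞
        (fun z => (⟨z, X z⟩ : TangentBundle 𝓘(ℝ, E) M)) x₀ := by
      refine (e.contMDiffAt_section_iff hb).2 ?_
      exact (hfat.contMDiffAt.comp x₀ hφat).congr_of_eventuallyEq heq
    refine ⟨hXs, ?_⟩
    ext w
    -- In coordinates `∇_w X` is `df(dφ w) + Γ(f, dφ w)`, which vanishes by the equation for `df`.
    have h1 := trivialization_cov e cov hb (hXs.mdifferentiableAt (by simp)) w
    have h2 : mvfderiv 𝓘(ℝ, E) (f ∘ φ) x₀ w = fderiv ℝ f (φ x₀) (mvfderiv 𝓘(ℝ, E) φ x₀ w) := by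
      refine (mfderiv_comp_apply x₀ (hfat.contMDiffAt.mdifferentiableAt (by simp))
        (hφat.mdifferentiableAt (by simp)) w).trans ?_
      rw [mfderiv_eq_fderiv]
      rfl
    rw [mvfderiv_congr_of_eventuallyEq heq, h2,
      hΓ.cov_constSection _ (mem_extChartAt_source x₀) (Metric.mem_ball_self hr),
      snd_trivializationAt_eq_mfderiv x₀ (mem_extChartAt_source x₀) w,
      (hfd _ (Metric.mem_ball_self hr)).fderiv, show (e ⟨x₀, X x₀⟩).2 = f (φ x₀) from heq.eq_of_nhds,
      neg_apply, neg_add_cancel, ← e.continuousLinearMapAt_apply_of_mem (R := ℝ) hb] at h1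
    rw [← e.symmL_continuousLinearMapAt (R := ℝ) hb (cov.toFun X x₀ w), h1, map_zero]
    rfl
  refine ⟨⟨X, fun x₀ => (key x₀).1⟩, fun x₀ => (key x₀).2, ?_⟩
  have hXv' : X x = v := by simpa using hXv
  exact hXv'

end AffineConnection
end

/-! ### Testing `∇J` and the torsion on parallel fields. -/

noncomputable section

open Filter Topology

variable {E : Type*} [NormedAddCommGroup E] [NormedSpace ℝ E]
  {M : Type*} [TopologicalSpace M] [ChartedSpace E M] [IsManifold 𝓘(ℝ, E) ∞ M]

namespace AffineConnection

/-- `∇J` is a tensor: `∇_v (JY) - J ∇_v Y` depends only on the value of `Y` at the point. -/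
lemma tensorialAt_cov_apply_sub (cov : AffineConnection E M) (J : AlmostComplexStructure E M)
    (x : M) (v : TangentSpace 𝓘(ℝ, E) x) :
    TensorialAt 𝓘(ℝ, E) E (fun Y : ∀ y : M, TangentSpace 𝓘(ℝ, E) y =>
      cov.toFun (fun y => J.toFun y (Y y)) x v - J.toFun x (cov.toFun Y x v)) x := by
  have hJ : ∀ {Y : ∀ y : M, TangentSpace 𝓘(ℝ, E) y},
      MDifferentiableAt 𝓘(ℝ, E) (𝓘(ℝ, E).prod 𝓘(ℝ, E))
        (fun y => (⟨y, Y y⟩ : TangentBundle 𝓘(ℝ, E) M)) x →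
      MDifferentiableAt 𝓘(ℝ, E) (𝓘(ℝ, E).prod 𝓘(ℝ, E))
        (fun y => (⟨y, J.toFun y (Y y)⟩ : TangentBundle 𝓘(ℝ, E) M)) x := fun hY =>
    ((J.contMDiff_toFun x).mdifferentiableAt (by simp)).clm_bundle_apply hY
  constructor
  · intro f Y hf hY
    have h1 : (fun y => J.toFun y ((f • Y) y)) = f • fun y => J.toFun y (Y y) := by
      funext y
      exact map_smul _ _ _
    rw [h1, cov.isCovariantDerivativeOnUniv.leibniz (hJ hY) hf (mem_univ x),
      cov.isCovariantDerivativeOnUniv.leibniz hY hf (mem_univ x)]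
    simp only [add_apply, smul_apply, ContinuousLinearMap.smulRight_apply, map_add, map_smul]
    module
  · intro Y Z hY hZ
    have h1 : (fun y => J.toFun y ((Y + Z) y)) =
        (fun y => J.toFun y (Y y)) + fun y => J.toFun y (Z y) := by
      funext y
      exact map_add _ _ _
    rw [h1, cov.isCovariantDerivativeOnUniv.add (hJ hY) (hJ hZ) (mem_univ x),
      cov.isCovariantDerivativeOnUniv.add hY hZ (mem_univ x)]
    simp only [add_apply, map_add]
    module

variable [FiniteDimensional ℝ E]

/-- By tensoriality `Y` may be replaced by a parallel `X` with the same value at `x`, for which `∇X`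
and `∇(JX)` both vanish. -/
lemma isComplex_of_apply_mem_parallelFields {cov : AffineConnection E M}
    {J : AlmostComplexStructure E M}
    (hspan : ∀ (x : M) (v : TangentSpace 𝓘(ℝ, E) x), ∃ X ∈ cov.parallelFields, X x = v)
    (hJ : ∀ X ∈ cov.parallelFields, J.apply X ∈ cov.parallelFields) : cov.IsComplex J := by
  intro Y x v
  obtain ⟨X, hX, hXY⟩ := hspan x (Y x)
  have h := (cov.tensorialAt_cov_apply_sub J x v).pointwise
    ((Y.contMDiff x).mdifferentiableAt (by simp)) ((X.contMDiff x).mdifferentiableAt (by simp))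
    hXY.symm
  have hX0 : cov.toFun X x = 0 := hX x
  have hJX0 : cov.toFun (fun y => J.toFun y (X y)) x = 0 := hJ X hX x
  beta_reduce at h
  rw [hX0, hJX0, zero_apply, map_zero, sub_zero] at h
  exact sub_eq_zero.1 h

lemma torsion_apply_of_mem_parallelFields {cov : AffineConnection E M}
    {X Y : SmoothVectorField E M} (hX : X ∈ cov.parallelFields) (hY : Y ∈ cov.parallelFields)
    (x : M) : CovariantDerivative.torsion cov x (X x) (Y x) =
      -VectorField.mlieBracket 𝓘(ℝ, E) X Y x := by
  have hX0 : cov.toFun X x = 0 := hX x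
  have hY0 : cov.toFun Y x = 0 := hY x
  rw [CovariantDerivative.torsion_apply cov ((X.contMDiff x).mdifferentiableAt (by simp))
    ((Y.contMDiff x).mdifferentiableAt (by simp)), hX0, hY0]
  simp

end AffineConnection

end

theorem corollary3p7
    {E : Type*} [NormedAddCommGroup E] [NormedSpace ℝ E] [FiniteDimensional ℝ E]
    {M : Type*} [TopologicalSpace M] [T2Space M] [ConnectedSpace M]
    [ChartedSpace E M] [IsManifold 𝓘(ℝ, E) ∞ M]
    (J : AlmostComplexStructure E M) (hJ : J.IsIntegrable)
    (cov : AffineConnection E M) [CovariantDerivative.ContMDiffCovariantDerivative cov ∞]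
    (hcov : cov.HasTrivialHolonomy) :
    cov.IsChernType J ↔
      (∀ X ∈ cov.parallelFields, J.apply X ∈ cov.parallelFields) ∧
      (∀ X ∈ cov.parallelFields, ∀ Y ∈ cov.parallelFields, ∀ x : M,
        J.toFun x (VectorField.mlieBracket 𝓘(ℝ, E) X Y x)
          = VectorField.mlieBracket 𝓘(ℝ, E) X (J.apply Y) x) := by
  constructor
  · intro h
    have hstab : ∀ X ∈ cov.parallelFields, J.apply X ∈ cov.parallelFields := by
      intro X hX x
      ext v
      have hX0 : cov.toFun X x = 0 := hX x
      rw [h.isComplex X x v, hX0, zero_apply, map_zero]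
    refine ⟨hstab, fun X hX Y hY x => ?_⟩
    -- The torsion condition puts `J` in the first slot and the bracket identity in the second, so
    -- the arguments are exchanged here and swapped back by antisymmetry.
    have h1 := h.torsion_type x (Y x) (X x)
    rw [AffineConnection.torsion_apply_of_mem_parallelFields hY hX] at h1
    have h2 := AffineConnection.torsion_apply_of_mem_parallelFields (hstab Y hY) hX x
    have h3 := h2.symm.trans h1
    rw [map_neg, neg_inj] at h3
    rw [VectorField.mlieBracket_swap_apply (V := X) (W := Y),
      VectorField.mlieBracket_swap_apply (V := X) (W := J.apply Y), map_neg, h3]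
  · rintro ⟨hstab, hbr⟩
    -- The extension theorem enters only in this direction: identities known on parallel fields must
    -- be carried to all tangent vectors.
    have hspan := fun x v => hcov.exists_parallelField x v
    refine ⟨AffineConnection.isComplex_of_apply_mem_parallelFields hspan hstab, hcov,
      fun x u v => ?_⟩
    obtain ⟨X, hX, rfl⟩ := hspan x u
    obtain ⟨Y, hY, rfl⟩ := hspan x v
    have h1 := AffineConnection.torsion_apply_of_mem_parallelFields (hstab X hX) hY x
    refine h1.trans ?_
    rw [AffineConnection.torsion_apply_of_mem_parallelFields hX hY, map_neg, neg_inj,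
      VectorField.mlieBracket_swap_apply (V := J.apply X) (W := Y), ← hbr Y hY X hX x,
      VectorField.mlieBracket_swap_apply (V := Y) (W := X), map_neg, neg_neg]
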